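/- **Proposition 2.** All norms are Frobenius (Euclidean) norms. A *mode tree* $\mathcal{T}$ over $[N]=\{1,\dots,N\}$ is a finite rooted tree in which every node is labeled by a subset of $[N]$, there are exactly $N$ leaves, labeled $\{1\},\dots,\{N\}$, and the label of each interior (non-leaf) node is the union of the labels of its children. Let $|\mathcal{T}|$ be the number of nodes, $\mathrm{int}(\mathcal{T})$ the set of interior nodes, $C(\nu)$ the set of children of $\nu$, and $Pa(\nu)$ the parent of a non-root node $\nu$; below, a node is also written for its label. Let $D_1,\dots,D_N$ and $(R_\nu)_{\nu\in\mathrm{int}(\mathcal{T})}$ be natural numbers; put $R_\nu:=D_n$ for the leaf $\nu$ labeled $\{n\}$, and $R_{Pa(\nu)}:=1$ for the root $\nu$. Let $W^{(\nu)}\in\mathbb{R}^{R_\nu\times R_{Pa(\nu)}}$, $\nu\in\mathcal{T}$, be weight matrices. For $r\in[R_{Pa(\nu)}]$ define tensors $\mathcal{W}^{(\nu,r)}$, with modes indexed by the label of $\nu$, from the leaves to the root by $\mathcal{W}^{(\nu,r)}:=W^{(\nu)}_{:,r}$ if $\nu$ is a leaf and $$\mathcal{W}^{(\nu,r)}:=\sum_{r'=1}^{R_\nu}W^{(\nu)}_{r',r}\,\bigotimes_{\nu_c\in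 C(\nu)}\mathcal{W}^{(\nu_c,r')}$$ if $\nu$ is interior (the modes of the tensor product being arranged in ascending order). The *end tensor* $\mathcal{W}_{\mathrm H}\in\mathbb{R}^{D_1,\dots,D_N}$ is $\mathcal{W}^{(\nu,1)}$ for the root $\nu$. For $\nu\in\mathrm{int}(\mathcal{T})$ and $r\in[R_\nu]$, the local component norm is $\sigma^{(\nu,r)}:=\big\|W^{(\nu)}_{r,:}\otimes\bigotimes_{\nu_c\in C(\nu)}W^{(\nu_c)}_{:,r}\big\|$. For $\mathcal{W}\in\mathbb{R}^{D_1,\dots,D_N}$ and $I\subseteq[N]$, $[\![\mathcal{W}]\!]_I$ is the matricization of $\mathcal{W}$ whose rows correspond to the modes in $I$ and whose columns correspond to the remaining modes. Let $B:=\max_{\nu\in\mathcal{T}}\|W^{(\nu)}\|$, let $\epsilon\ge 0$ and let $(R'_\nu)_{\nu\in\mathrm{int}(\mathcal{T})}$ be natural numbers. Suppose that for every $\nu\in\mathrm{int}(\mathcal{T})$ $$\sum_{r=R'_\nu+1}^{R_\nu}\sigma^{(\nu,r)}\le\epsilon\,(|\mathcal{T}|-N)^{-1}\,B^{|C(\nu)|+1-|\mathcal{T}|}$$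 (if $B=0$, a negative power of $B$ is read as $0$). Then there is a tensor $\mathcal{W}\in\mathbb{R}^{D_1,\dots,D_N}$ with $\mathrm{rank}\,[\![\mathcal{W}]\!]_\nu\le R'_{Pa(\nu)}$ for every non-root node $\nu$ and $\|\mathcal{W}_{\mathrm H}-\mathcal{W}\|\le\epsilon$; in particular the infimum of $\|\mathcal{W}_{\mathrm H}-\mathcal{W}\|$ over all tensors $\mathcal{W}$ satisfying these rank bounds is at most $\epsilon$. -/

import Mathlib

universe u

/-- A mode tree over `[N]`: a finite rooted tree (Mathlib's `RootedTree`: the root is `⊥`, the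
parent of a node is `Order.pred`) in which every node is labeled by a subset of `[N]`, the leaves
are exactly the `N` nodes `leaf n` with labels `{n}`, and the label of an interior node is the union
of the labels of its children. The modes `1, …, N` are represented by `Fin N`. -/
structure ModeTree (N : ℕ) where
  tree : RootedTree.{u}
  [fintype : Fintype tree]
  [decidableEq : DecidableEq tree]
  label : tree → Finset (Fin N)
  leaf : Fin N → tree
  label_leaf : ∀ n, label (leaf n) = {n}
  isLeaf_iff : ∀ v : tree, (∀ c : tree, c ≠ ⊥ → Order.pred c ≠ v) ↔ ∃ n, leaf n = v
  label_interior : ∀ v : tree, (∃ c : tree, c ≠ ⊥ ∧ Order.pred c = v) →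
    label v = (Finset.univ.filter fun c : tree => c ≠ ⊥ ∧ Order.pred c = v).biUnion label

attribute [instance] ModeTree.fintype ModeTree.decidableEq

namespace ModeTree

variable {N : ℕ} (T : ModeTree.{u} N)

/-- The nodes of the tree. -/
abbrev Node : Type u := T.tree

/-- The root, whose label is `[N]`. -/
def root : T.Node := ⊥

/-- The parent of a non-root node (its value at the root is never used). -/
def parent (v : T.Node) : T.Node := Order.pred v

/-- The set of children of a node. -/
def children (v : T.Node) : Finset T.Node :=
  Finset.univ.filter fun c => c ≠ T.root ∧ T.parent c = v

/-- Interior nodes are the nodes that have a child; the other ones are leaves. -/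
def IsInterior (v : T.Node) : Prop := (T.children v).Nonempty

theorem mem_children {v c : T.Node} : c ∈ T.children v ↔ c ≠ T.root ∧ T.parent c = v := by
  simp [children]

theorem lt_of_mem_children {v c : T.Node} (h : c ∈ T.children v) : v < c := by
  obtain ⟨h1, h2⟩ := T.mem_children.1 h
  rw [← h2]
  exact Order.pred_lt_of_not_isMin fun hm => h1 hm.eq_bot

theorem label_subset_of_mem_children {v c : T.Node} (h : c ∈ T.children v) :
    T.label c ⊆ T.label v := by
  rw [T.label_interior v ⟨c, T.mem_children.1 h⟩]
  exact Finset.subset_biUnion_of_mem T.label (T.mem_children.2 (T.mem_children.1 h))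

theorem exists_leaf_eq {v : T.Node} (h : ¬ T.IsInterior v) : ∃ n, T.leaf n = v :=
  (T.isLeaf_iff v).1 fun c hc hp => h ⟨c, T.mem_children.2 ⟨hc, hp⟩⟩

/-- The mode `n` of a leaf labeled `{n}`. -/
noncomputable def leafMode {v : T.Node} (h : ¬ T.IsInterior v) : Fin N :=
  Classical.choose (T.exists_leaf_eq h)

theorem leaf_leafMode {v : T.Node} (h : ¬ T.IsInterior v) : T.leaf (T.leafMode h) = v :=
  Classical.choose_spec (T.exists_leaf_eq h)

theorem leafMode_mem {v : T.Node} (h : ¬ T.IsInterior v) : T.leafMode h ∈ T.label v := by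
  have h1 := T.label_leaf (T.leafMode h)
  rw [T.leaf_leafMode h] at h1
  simp [h1]

/-- The dimension `D_n` of the mode `n`. The family `R` gives the number `R_v` of local components
at every interior node `v`, and is extended to the leaves by `R_{{n}} := D_n`. -/
def modeDim (R : T.Node → ℕ) (n : Fin N) : ℕ := R (T.leaf n)

/-- `R_{Pa(v)}`, with the convention `R_{Pa([N])} := 1` at the root. -/
def parentDim (R : T.Node → ℕ) (v : T.Node) : ℕ := if v = T.root then 1 else R (T.parent v)

theorem parentDim_root (R : T.Node → ℕ) : T.parentDim R T.root = 1 := by simp [parentDim]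

theorem parentDim_of_mem_children (R : T.Node → ℕ) {v c : T.Node} (h : c ∈ T.children v) :
    T.parentDim R c = R v := by
  obtain ⟨h1, h2⟩ := T.mem_children.1 h
  simp [parentDim, h1, h2]

/-- Weight matrices `W^{(v)} ∈ ℝ^{R_v, R_{Pa(v)}}`, one for each node `v`. -/
abbrev Weights (R : T.Node → ℕ) : Type u :=
  ∀ v : T.Node, Matrix (Fin (R v)) (Fin (T.parentDim R v)) ℝ

/-- Multi-indices of a tensor whose modes are the elements of `I ⊆ [N]`. Modes are addressed by
name, so no permutation of modes is needed when tensors with disjoint sets of modes are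
multiplied. -/
abbrev Index (R : T.Node → ℕ) (I : Finset (Fin N)) : Type :=
  ∀ i : {n // n ∈ I}, Fin (T.modeDim R i.1)

/-- Tensors in `ℝ^{D_1, …, D_N}`, with the Frobenius norm. -/
abbrev Tensor (R : T.Node → ℕ) : Type :=
  EuclideanSpace ℝ (∀ n : Fin N, Fin (T.modeDim R n))

variable {T} {R : T.Node → ℕ}

/-- For a child `c` of `v`, an element of `[R_v]` viewed as a column index of `W^{(c)}`. -/
def colIdx {v c : T.Node} (h : c ∈ T.children v) (r : Fin (R v)) : Fin (T.parentDim R c) :=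
  Fin.cast (T.parentDim_of_mem_children R h).symm r

/-- A multi-index over the label of `v`, restricted to the label of a child `c`. -/
def restrictIdx {v c : T.Node} (h : c ∈ T.children v) (d : T.Index R (T.label v)) :
    T.Index R (T.label c) :=
  fun i => d ⟨i.1, T.label_subset_of_mem_children h i.2⟩

/-- A multi-index over the label `{n}` of a leaf, viewed as a row index of its weight matrix. -/
noncomputable def leafIdx {v : T.Node} (h : ¬ T.IsInterior v) (d : T.Index R (T.label v)) :
    Fin (R v) :=
  Fin.cast (congrArg R (T.leaf_leafMode h)) (d ⟨T.leafMode h, T.leafMode_mem h⟩)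

open Classical in
/-- The intermediate tensors `𝒲^{(v, r)}`, for `r ∈ [R_{Pa(v)}]`, as functions of the multi-index
`d` over the label of `v`: `𝒲^{(v, r)} = W^{(v)}_{:, r}` at a leaf, and
`𝒲^{(v, r)} = ∑_{r'} W^{(v)}_{r', r} ⨂_{c ∈ C(v)} 𝒲^{(c, r')}` at an interior node. -/
noncomputable def intermediate (W : T.Weights R) (v : T.Node) (r : Fin (T.parentDim R v))
    (d : T.Index R (T.label v)) : ℝ :=
  if h : T.IsInterior v then
    ∑ r' : Fin (R v), W v r' r *
      ∏ c : {c // c ∈ T.children v}, intermediate W c.1 (colIdx c.2 r') (restrictIdx c.2 d)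
  else W v (leafIdx h d) r
termination_by Fintype.card {w : T.Node // v < w}
decreasing_by
  have hc := T.lt_of_mem_children c.2
  exact Fintype.card_lt_of_injective_of_notMem
    (fun w : {w : T.Node // c.1 < w} => (⟨w.1, hc.trans w.2⟩ : {w : T.Node // v < w}))
    (fun a b hab => Subtype.ext (congrArg (fun x : {w : T.Node // v < w} => x.1) hab))
    (b := ⟨c.1, hc⟩) (by rintro ⟨w, hw⟩; exact w.2.ne' (congrArg Subtype.val hw))

/-- The end tensor of the hierarchical tensor factorization. -/
noncomputable def endTensor (W : T.Weights R) : T.Tensor R :=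
  WithLp.toLp 2 fun d =>
    intermediate W T.root (Fin.cast (T.parentDim_root R).symm 0) fun i => d i.1

/-- The `(v, r)`'th local component `W^{(v)}_{r, :} ⊗ (⨂_{c ∈ C(v)} W^{(c)}_{:, r})`. -/
noncomputable def localComponent (W : T.Weights R) (v : T.Node) (r : Fin (R v)) :
    EuclideanSpace ℝ (Fin (T.parentDim R v) × ∀ c : {c // c ∈ T.children v}, Fin (R c.1)) :=
  WithLp.toLp 2 fun p => W v r p.1 * ∏ c : {c // c ∈ T.children v}, W c.1 (p.2 c) (colIdx c.2 r)

/-- The (Frobenius) norm of the `(v, r)`'th local component. -/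
noncomputable def localComponentNorm (W : T.Weights R) (v : T.Node) (r : Fin (R v)) : ℝ :=
  ‖localComponent W v r‖

open scoped Matrix.Norms.Frobenius in
/-- `max_v ‖W^{(v)}‖`, with Frobenius norms. -/
noncomputable def maxWeightNorm (W : T.Weights R) : ℝ :=
  Finset.univ.sup' ⟨T.root, Finset.mem_univ _⟩ fun v => ‖W v‖

/-- The matricization of a tensor with respect to `I ⊆ [N]`: rows correspond to the modes in `I`
and columns to the other modes. -/
def matricize (A : T.Tensor R) (I : Finset (Fin N)) :
    Matrix (T.Index R I) (∀ j : {n // n ∉ I}, Fin (T.modeDim R j.1)) ℝ :=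
  Matrix.of fun a b => A fun n => if h : n ∈ I then a ⟨n, h⟩ else b ⟨n, h⟩

/-- The tensors whose hierarchical tensor rank is at most `(R'_{Pa(v)})_v` element-wise, `v` ranging
over the non-root nodes. -/
def lowRank (T : ModeTree.{u} N) (R : T.Node → ℕ) (R' : T.Node → ℕ) : Set (T.Tensor R) :=
  {A | ∀ v : T.Node, v ≠ T.root → (matricize A (T.label v)).rank ≤ R' (T.parent v)}

end ModeTree

/-! At every node `v`, the end tensor is the sum over `r` of the end tensors of the weights in which
row `r` of `W^{(v)}` and column `r` of the weight matrices of the children of `v` are the only ones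
left. The norm of an end tensor is at most the product of the norms of the weight matrices, and for
the `r`'th summand this product is `σ^{(v, r)}` times the norms of the weight matrices outside
`{v} ∪ C(v)`. So setting the rows `r > R'_v` of `W^{(v)}` to zero changes the end tensor by at most
`B^{|𝒯| - |C(v)| - 1} ∑_{r > R'_v} σ^{(v, r)} ≤ ε / (|𝒯| - N)`. There are `|𝒯| - N` interior nodes,
and pruning one of them does not increase the local component norms at the others, so pruning all of
them costs at most `ε`. Afterwards the columns of the matricization at a child `c` of `v` lie in the
span of those `𝒲^{(c, r)}` for which row `r` of `W^{(v)}` is still nonzero, of which there are at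
most `R'_v`. -/

section Sums

variable {ι α M : Type*} {β : ι → Type*}

theorem sum_comp_le_sum_of_injective [Fintype ι] [Fintype α] [AddCommMonoid M] [PartialOrder M]
    [IsOrderedAddMonoid M] {e : ι → α} (he : Function.Injective e) {f : α → M}
    (hf : ∀ a, 0 ≤ f a) : ∑ i, f (e i) ≤ ∑ a, f a :=
  (Finset.sum_map Finset.univ ⟨e, he⟩ f).symm.trans_le <|
    Finset.sum_le_sum_of_subset_of_nonneg (Finset.subset_univ _) fun a _ _ => hf a

theorem sum_prod_le_prod_sum_of_injective [Fintype ι] [Fintype α] [∀ i, Fintype (β i)]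
    [CommSemiring M] [PartialOrder M] [IsOrderedRing M] {e : ∀ i, α → β i}
    (he : Function.Injective fun a i => e i a) {f : ∀ i, β i → M} (hf : ∀ i b, 0 ≤ f i b) :
    ∑ a, ∏ i, f i (e i a) ≤ ∏ i, ∑ b, f i b := by
  classical
  rw [Fintype.prod_sum]
  exact sum_comp_le_sum_of_injective he (f := fun b : ∀ i, β i => ∏ i, f i (b i))
    fun b => Finset.prod_nonneg fun i _ => hf i (b i)

end Sums

theorem dist_le_sum_of_dist_update_le {ι E : Type*} [Fintype ι] [DecidableEq ι] {M : ι → Type*}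
    [PseudoMetricSpace E] (f : (∀ i, M i) → E) (a b : ∀ i, M i) (C : ι → ℝ)
    (h : ∀ i x, x i = a i → (∀ j, x j = a j ∨ x j = b j) →
      dist (f x) (f (Function.update x i (b i))) ≤ C i) :
    dist (f a) (f b) ≤ ∑ i, C i := by
  have hybrid (s : Finset ι) : dist (f a) (f (s.piecewise b a)) ≤ ∑ i ∈ s, C i := by
    induction s using Finset.induction_on with
    | empty => simp
    | insert i s hi ih =>
      rw [Finset.sum_insert hi, add_comm, Finset.piecewise_insert]
      refine (dist_triangle _ _ _).trans (add_le_add ih (h i _ ?_ fun j => ?_))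
      · exact s.piecewise_eq_of_notMem _ _ hi
      · exact (em (j ∈ s)).symm.imp (s.piecewise_eq_of_notMem _ _) (s.piecewise_eq_of_mem _ _)
  simpa using hybrid Finset.univ

section Frobenius

open scoped Matrix.Norms.Frobenius

variable {m n α : Type*} [Fintype m] [Fintype n] [SeminormedAddCommGroup α]

theorem frobenius_norm_sq (A : Matrix m n α) : ‖A‖ ^ 2 = ∑ i, ∑ j, ‖A i j‖ ^ 2 := by
  simp only [Matrix.frobenius_norm_def, Real.rpow_two]
  rw [← Real.sqrt_eq_rpow, Real.sq_sqrt (by positivity)]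

theorem frobenius_norm_le_of_norm_apply_le {A B : Matrix m n α}
    (h : ∀ i j, ‖A i j‖ ≤ ‖B i j‖) : ‖A‖ ≤ ‖B‖ := by
  refine le_of_sq_le_sq ?_ (norm_nonneg _)
  simp only [frobenius_norm_sq]
  gcongr
  exact h _ _

end Frobenius

namespace ModeTree

open scoped Matrix Matrix.Norms.Frobenius

section Tree

variable {N : ℕ} (T : ModeTree.{u} N) {u v w c c' : T.Node}

theorem mem_children_iff_covBy : c ∈ T.children v ↔ v ⋖ c := by
  rw [mem_children]
  constructor
  · rintro ⟨hc, rfl⟩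
    exact Order.pred_covBy_of_not_isMin fun hm => hc hm.eq_bot
  · exact fun h => ⟨(bot_le.trans_lt h.lt).ne', h.pred_eq⟩

theorem exists_mem_children_le (h : u < v) : ∃ c ∈ T.children u, c ≤ v := by
  simpa only [mem_children_iff_covBy] using exists_covBy_le_of_lt h

theorem eq_of_mem_children_of_le (hc : c ∈ T.children u) (hc' : c' ∈ T.children u)
    (h : c ≤ w) (h' : c' ≤ w) : c = c' := by
  rw [mem_children_iff_covBy] at hc hc'
  rcases le_total_of_directed h' h with hle | hle
  · exact (hc'.eq_or_eq hc.le hle).resolve_left hc.lt.ne'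
  · exact ((hc.eq_or_eq hc'.le hle).resolve_left hc'.lt.ne').symm

theorem not_le_of_mem_children_of_ne (hc : c ∈ T.children u) (hc' : c' ∈ T.children u)
    (hne : c ≠ c') (h : c' ≤ v) : ¬ c ≤ v ∧ ¬ v ≤ c :=
  ⟨fun hle => hne (T.eq_of_mem_children_of_le hc hc' hle h),
    fun hle => hne (T.eq_of_mem_children_of_le hc hc' le_rfl (h.trans hle))⟩

theorem isInterior_of_lt (h : u < v) : T.IsInterior u :=
  let ⟨c, hc, _⟩ := T.exists_mem_children_le h
  ⟨c, hc⟩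

theorem isInterior_parent (hv : v ≠ T.root) : T.IsInterior (T.parent v) :=
  ⟨v, T.mem_children.2 ⟨hv, rfl⟩⟩

theorem not_isInterior_iff : ¬ T.IsInterior v ↔ ∃ n, T.leaf n = v := by
  rw [← T.isLeaf_iff, IsInterior, Finset.not_nonempty_iff_eq_empty,
    Finset.eq_empty_iff_forall_notMem]
  simp only [mem_children, not_and]
  rfl

theorem label_eq_biUnion (hv : T.IsInterior v) :
    T.label v = (T.children v).biUnion T.label :=
  T.label_interior v (hv.imp fun _ hc => T.mem_children.1 hc)

theorem leaf_injective : Function.Injective T.leaf := fun m n h => by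
  simpa only [T.label_leaf, Finset.singleton_inj] using congrArg T.label h

theorem mem_label_iff {n : Fin N} : n ∈ T.label v ↔ v ≤ T.leaf n := by
  induction v using WellFoundedGT.induction with
  | ind v ih =>
    by_cases hv : T.IsInterior v
    · rw [T.label_eq_biUnion hv, Finset.mem_biUnion]
      constructor
      · rintro ⟨c, hc, hn⟩
        have hvc := T.lt_of_mem_children hc
        exact hvc.le.trans ((ih c hvc).1 hn)
      · intro h
        have hne : v ≠ T.leaf n := fun he => T.not_isInterior_iff.2 ⟨n, he.symm⟩ hv
        obtain ⟨c, hc, hcn⟩ := T.exists_mem_children_le (h.lt_of_ne hne)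
        exact ⟨c, hc, (ih c (T.lt_of_mem_children hc)).2 hcn⟩
    · obtain ⟨m, rfl⟩ := T.exists_leaf_eq hv
      rw [T.label_leaf, Finset.mem_singleton]
      constructor
      · rintro rfl
        exact le_rfl
      · exact fun h =>
          (T.leaf_injective (eq_of_le_of_not_lt h fun hlt => hv (T.isInterior_of_lt hlt))).symm

theorem mem_label_root (n : Fin N) : n ∈ T.label T.root :=
  T.mem_label_iff.2 bot_le

theorem disjoint_label (h : ¬ u ≤ v) (h' : ¬ v ≤ u) : Disjoint (T.label u) (T.label v) :=
  Finset.disjoint_left.2 fun _ hu hv =>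
    (le_total_of_directed (T.mem_label_iff.1 hv) (T.mem_label_iff.1 hu)).elim h h'

open Classical in
/-- The set of nodes of the subtree rooted at `v`. -/
noncomputable def subtree (v : T.Node) : Finset T.Node := {w | v ≤ w}

theorem mem_subtree : w ∈ T.subtree v ↔ v ≤ w := by simp [subtree]

theorem subtree_root : T.subtree T.root = Finset.univ :=
  Finset.eq_univ_of_forall fun _ => T.mem_subtree.2 bot_le

theorem subtree_eq_insert_biUnion (v : T.Node) :
    T.subtree v = insert v ((T.children v).biUnion T.subtree) := by
  ext w
  simp only [mem_subtree, Finset.mem_insert, Finset.mem_biUnion]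
  constructor
  · exact fun h => h.eq_or_lt.imp Eq.symm T.exists_mem_children_le
  · rintro (rfl | ⟨c, hc, hcw⟩)
    · exact le_rfl
    · exact (T.lt_of_mem_children hc).le.trans hcw

theorem prod_subtree {M : Type*} [CommMonoid M] (f : T.Node → M) (v : T.Node) :
    ∏ w ∈ T.subtree v, f w = f v * ∏ c ∈ T.children v, ∏ w ∈ T.subtree c, f w := by
  have hv : v ∉ (T.children v).biUnion T.subtree := fun h => by
    obtain ⟨c, hc, hcv⟩ := Finset.mem_biUnion.1 h
    exact (T.lt_of_mem_children hc).not_ge (T.mem_subtree.1 hcv)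
  rw [subtree_eq_insert_biUnion, Finset.prod_insert hv, Finset.prod_biUnion]
  exact fun c hc c' hc' hne => Finset.disjoint_left.2 fun w hw hw' =>
    hne (T.eq_of_mem_children_of_le hc hc' (T.mem_subtree.1 hw) (T.mem_subtree.1 hw'))

open Classical in
theorem card_interior_add (T : ModeTree.{u} N) :
    (Finset.univ.filter T.IsInterior).card + N = Fintype.card T.Node := by
  have hleaves : (Finset.univ.filter fun v => ¬ T.IsInterior v) = Finset.univ.image T.leaf := by
    ext v
    simp [T.not_isInterior_iff]
  rw [← Finset.card_univ, ← Finset.card_filter_add_card_filter_not (s := Finset.univ) T.IsInterior,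
    hleaves, Finset.card_image_of_injective _ T.leaf_injective, Finset.card_univ, Fintype.card_fin]

end Tree

variable {N : ℕ} {T : ModeTree.{u} N} {R : T.Node → ℕ} {u v c : T.Node}

section Intermediate

theorem intermediate_of_not_isInterior (W : T.Weights R) (hv : ¬ T.IsInterior v)
    (s : Fin (T.parentDim R v)) (d : T.Index R (T.label v)) :
    intermediate W v s d = W v (leafIdx hv d) s := by
  rw [intermediate, dif_neg hv]

/-- The tensor products `⨂_{c ∈ C(v)} 𝒲^{(c, r)}`, for `r ∈ [R_v]`, as the rows of a matrix. -/
noncomputable def childTensor (W : T.Weights R) (v : T.Node) :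
    Matrix (Fin (R v)) (T.Index R (T.label v)) ℝ :=
  Matrix.of fun r d =>
    ∏ c : {c // c ∈ T.children v}, intermediate W c.1 (colIdx c.2 r) (restrictIdx c.2 d)

theorem intermediate_of_isInterior (W : T.Weights R) (hv : T.IsInterior v)
    (s : Fin (T.parentDim R v)) (d : T.Index R (T.label v)) :
    intermediate W v s d = ∑ r, W v r s * childTensor W v r d := by
  rw [intermediate, dif_pos hv]
  rfl

theorem intermediate_congr {W W' : T.Weights R} {s : Fin (T.parentDim R v)}
    (hs : ∀ r, W v r s = W' v r s) (h : ∀ w, v < w → W w = W' w)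
    (d : T.Index R (T.label v)) : intermediate W v s d = intermediate W' v s d := by
  induction v using WellFoundedGT.induction with
  | ind v ih =>
    by_cases hv : T.IsInterior v
    · simp only [intermediate_of_isInterior _ hv, hs, childTensor, Matrix.of_apply]
      refine Finset.sum_congr rfl fun r _ => congrArg _ (Finset.prod_congr rfl fun c _ => ?_)
      have hc := T.lt_of_mem_children c.2
      exact ih c.1 hc (fun r' => by rw [h c.1 hc]) (fun w hw => h w (hc.trans hw)) _
    · rw [intermediate_of_not_isInterior _ hv, intermediate_of_not_isInterior _ hv, hs]

theorem intermediate_eq_sum_mul_child (W : T.Weights R) (hc : c ∈ T.children u)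
    (s : Fin (T.parentDim R u)) (d : T.Index R (T.label u)) :
    intermediate W u s d = ∑ r,
      (W u r s * ∏ c' ∈ Finset.univ.erase (⟨c, hc⟩ : {c // c ∈ T.children u}),
        intermediate W c'.1 (colIdx c'.2 r) (restrictIdx c'.2 d)) *
      intermediate W c (colIdx hc r) (restrictIdx hc d) := by
  rw [intermediate_of_isInterior W ⟨c, hc⟩]
  refine Finset.sum_congr rfl fun r _ => ?_
  rw [childTensor, Matrix.of_apply, ← Finset.prod_erase_mul _ _ (Finset.mem_univ ⟨c, hc⟩),
    mul_assoc]

end Intermediate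

section Norm

theorem leafIdx_injective (hv : ¬ T.IsInterior v) :
    Function.Injective (leafIdx (R := R) hv) := by
  have hlabel : T.label v = {T.leafMode hv} := by
    rw [← T.label_leaf, T.leaf_leafMode]
  intro d d' h
  funext ⟨i, hi⟩
  obtain rfl : i = T.leafMode hv := Finset.mem_singleton.1 (hlabel ▸ hi)
  exact Fin.cast_injective _ h

theorem colIdx_restrictIdx_injective (hv : T.IsInterior v) :
    Function.Injective fun (p : Fin (R v) × T.Index R (T.label v))
      (c : {c // c ∈ T.children v}) => (colIdx c.2 p.1, restrictIdx c.2 p.2) := by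
  rintro ⟨r, d⟩ ⟨r', d'⟩ h
  have h (c : {c // c ∈ T.children v}) := Prod.ext_iff.1 (congrFun h c)
  refine Prod.ext ?_ (funext fun ⟨i, hi⟩ => ?_)
  · obtain ⟨c, hc⟩ := hv
    exact Fin.cast_injective (T.parentDim_of_mem_children R hc).symm (h ⟨c, hc⟩).1
  · obtain ⟨c, hc, hic⟩ := Finset.mem_biUnion.1 (T.label_eq_biUnion hv ▸ hi)
    exact congrFun (h ⟨c, hc⟩).2 ⟨i, hic⟩

theorem norm_childTensor_le (W : T.Weights R) (hv : T.IsInterior v) :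
    ‖childTensor W v‖ ≤ ∏ c ∈ T.children v, ‖Matrix.of (intermediate W c)‖ := by
  refine le_of_sq_le_sq ?_ (by positivity)
  rw [← Finset.prod_pow, ← Finset.prod_coe_sort (T.children v)]
  simp only [frobenius_norm_sq, ← Fintype.sum_prod_type', childTensor, Matrix.of_apply, norm_prod,
    ← Finset.prod_pow]
  exact sum_prod_le_prod_sum_of_injective
    (f := fun (c : {c // c ∈ T.children v}) p => ‖intermediate W c.1 p.1 p.2‖ ^ 2)
    (colIdx_restrictIdx_injective hv) fun _ _ => sq_nonneg _

theorem norm_intermediate_le (W : T.Weights R) (v : T.Node) :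
    ‖Matrix.of (intermediate W v)‖ ≤ ∏ w ∈ T.subtree v, ‖W w‖ := by
  induction v using WellFoundedGT.induction with
  | ind v ih =>
    rw [prod_subtree]
    by_cases hv : T.IsInterior v
    · have hmul : Matrix.of (intermediate W v) = (W v)ᵀ * childTensor W v := by
        ext s d
        exact intermediate_of_isInterior W hv s d
      calc ‖Matrix.of (intermediate W v)‖ ≤ ‖(W v)ᵀ‖ * ‖childTensor W v‖ :=
            hmul ▸ Matrix.frobenius_norm_mul _ _
        _ ≤ ‖W v‖ * ∏ c ∈ T.children v, ‖Matrix.of (intermediate W c)‖ := by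
            rw [Matrix.frobenius_norm_transpose]
            gcongr
            exact norm_childTensor_le W hv
        _ ≤ _ := by
            gcongr with c hc
            exact ih c (T.lt_of_mem_children hc)
    · rw [Finset.not_nonempty_iff_eq_empty.1 hv, Finset.prod_empty, mul_one,
        ← Matrix.frobenius_norm_transpose (W v)]
      refine le_of_sq_le_sq ?_ (norm_nonneg _)
      simp only [frobenius_norm_sq, Matrix.of_apply, intermediate_of_not_isInterior W hv]
      exact Finset.sum_le_sum fun s _ => sum_comp_le_sum_of_injective
        (f := fun r => ‖(W v)ᵀ s r‖ ^ 2) (leafIdx_injective hv) fun _ => sq_nonneg _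

theorem norm_endTensor_le (W : T.Weights R) : ‖endTensor W‖ ≤ ∏ w, ‖W w‖ := by
  rw [← T.subtree_root]
  refine le_trans (le_of_sq_le_sq ?_ (norm_nonneg _)) (norm_intermediate_le W T.root)
  have hinj : Function.Injective
      fun (d : ∀ n : Fin N, Fin (T.modeDim R n)) (i : {n // n ∈ T.label T.root}) => d i.1 :=
    fun d d' h => funext fun n => congrFun h ⟨n, T.mem_label_root n⟩
  let s₀ : Fin (T.parentDim R T.root) := Fin.cast (T.parentDim_root R).symm 0
  calc ‖endTensor W‖ ^ 2 ≤ ∑ d, ‖intermediate W T.root s₀ d‖ ^ 2 := by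
        rw [EuclideanSpace.norm_sq_eq]
        exact sum_comp_le_sum_of_injective
          (f := fun d => ‖intermediate W T.root s₀ d‖ ^ 2) hinj fun _ => sq_nonneg _
    _ ≤ ∑ s, ∑ d, ‖intermediate W T.root s d‖ ^ 2 :=
        Finset.single_le_sum (f := fun s => ∑ d, ‖intermediate W T.root s d‖ ^ 2)
          (fun _ _ => by positivity) (Finset.mem_univ s₀)
    _ = ‖Matrix.of (intermediate W T.root)‖ ^ 2 := (frobenius_norm_sq _).symm

theorem endTensor_eq_zero_of_eq_zero {W : T.Weights R} (h : W v = 0) : endTensor W = 0 :=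
  norm_le_zero_iff.1 <| (norm_endTensor_le W).trans_eq <|
    Finset.prod_eq_zero (Finset.mem_univ v) (by rw [h, norm_zero])

end Norm

section Isolate

/-- The weights in which the `(v, r)`'th local component is the only one left at `v`: row `r` is
kept of `W^{(v)}` and column `r` of the weight matrices of the children of `v`. The indices are
compared as natural numbers because `r` and the entries of `W^{(w)}` live in different types. -/
noncomputable def isolate (W : T.Weights R) (v : T.Node) (r : Fin (R v)) : T.Weights R :=
  fun w => Matrix.of fun p q =>
    if (w = v → p.val = r.val) ∧ (w ∈ T.children v → q.val = r.val) then W w p q else 0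

variable (W : T.Weights R)

theorem isolate_self_apply (r p : Fin (R v)) (q : Fin (T.parentDim R v)) :
    isolate W v r v p q = if p = r then W v p q else 0 := by
  have hv : v ∉ T.children v := fun h => (T.lt_of_mem_children h).false
  simp [isolate, hv, Fin.ext_iff]

theorem isolate_child_apply (hc : c ∈ T.children v) (r : Fin (R v)) (p : Fin (R c))
    (q : Fin (T.parentDim R c)) :
    isolate W v r c p q = if q = colIdx hc r then W c p q else 0 := by
  simp [isolate, hc, (T.lt_of_mem_children hc).ne', Fin.ext_iff, colIdx]

theorem isolate_of_notMem (r : Fin (R v)) {w : T.Node} (hw : w ∉ insert v (T.children v)) :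
    isolate W v r w = W w := by
  rw [Finset.mem_insert, not_or] at hw
  ext p q
  simp [isolate, hw]

theorem isolate_of_not_le (r : Fin (R v)) {w : T.Node} (hw : ¬ v ≤ w) :
    isolate W v r w = W w :=
  isolate_of_notMem W r fun h => hw <| (Finset.mem_insert.1 h).elim Eq.ge
    fun h => (T.lt_of_mem_children h).le

theorem intermediate_isolate_child (hc : c ∈ T.children v) (r : Fin (R v))
    (d : T.Index R (T.label c)) :
    intermediate (isolate W v r) c (colIdx hc r) d = intermediate W c (colIdx hc r) d := by
  refine intermediate_congr (fun p => by rw [isolate_child_apply W hc, if_pos rfl])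
    (fun w hw => isolate_of_notMem W r fun h => ?_) d
  rcases Finset.mem_insert.1 h with rfl | hwv
  · exact (T.lt_of_mem_children hc).asymm hw
  · exact hw.ne (T.eq_of_mem_children_of_le hc hwv hw.le le_rfl)

theorem intermediate_isolate_of_not_le (h : ¬ u ≤ v) (h' : ¬ v ≤ u) (r : Fin (R v))
    (s : Fin (T.parentDim R u)) (d : T.Index R (T.label u)) :
    intermediate (isolate W v r) u s d = intermediate W u s d :=
  intermediate_congr (fun p => by rw [isolate_of_not_le W r h'])
    (fun _ hw => isolate_of_not_le W r fun hv => (le_total_of_directed hv hw.le).elim h h') d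

theorem intermediate_self_eq_sum_isolate (s : Fin (T.parentDim R v))
    (d : T.Index R (T.label v)) :
    intermediate W v s d = ∑ r, intermediate (isolate W v r) v s d := by
  by_cases hv : T.IsInterior v
  · have hchild (r : Fin (R v)) :
        childTensor (isolate W v r) v r d = childTensor W v r d :=
      Finset.prod_congr rfl fun c _ => intermediate_isolate_child W c.2 r _
    simp only [intermediate_of_isInterior _ hv, isolate_self_apply, ite_mul, zero_mul,
      Finset.sum_ite_eq', Finset.mem_univ, if_true, hchild]
  · simp [intermediate_of_not_isInterior _ hv, isolate_self_apply]

theorem intermediate_eq_sum_isolate (huv : u ≤ v) (s : Fin (T.parentDim R u))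
    (d : T.Index R (T.label u)) :
    intermediate W u s d = ∑ r, intermediate (isolate W v r) u s d := by
  induction u using WellFoundedGT.induction with
  | ind u ih =>
    rcases huv.eq_or_lt with rfl | hlt
    · exact intermediate_self_eq_sum_isolate W s d
    obtain ⟨c, hc, hcv⟩ := T.exists_mem_children_le hlt
    simp only [intermediate_eq_sum_mul_child _ hc, isolate_of_not_le W _ hlt.not_ge,
      ih c (T.lt_of_mem_children hc) hcv, Finset.mul_sum]
    rw [Finset.sum_comm]
    refine Finset.sum_congr rfl fun r _ => Finset.sum_congr rfl fun r' _ => ?_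
    congr 2
    refine Finset.prod_congr rfl fun c' hc' => ?_
    obtain ⟨h, h'⟩ := T.not_le_of_mem_children_of_ne c'.2 hc
      (fun he => Finset.ne_of_mem_erase hc' (Subtype.ext he)) hcv
    rw [intermediate_isolate_of_not_le W h h']

theorem endTensor_eq_sum_isolate (v : T.Node) :
    endTensor W = ∑ r, endTensor (isolate W v r) := by
  ext d
  simp only [endTensor, WithLp.ofLp_sum, Finset.sum_apply]
  exact intermediate_eq_sum_isolate W bot_le _ _

theorem localComponentNorm_eq_prod_isolate (r : Fin (R v)) :
    localComponentNorm W v r =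
      ‖isolate W v r v‖ * ∏ c ∈ T.children v, ‖isolate W v r c‖ := by
  have hself : ‖isolate W v r v‖ ^ 2 = ∑ q, ‖W v r q‖ ^ 2 := by
    rw [frobenius_norm_sq, Finset.sum_eq_single_of_mem r (Finset.mem_univ r)]
    · simp only [isolate_self_apply, if_pos]
    · exact fun p _ hp => by simp [isolate_self_apply, hp]
  have hchild (c : {c // c ∈ T.children v}) :
      ‖isolate W v r c.1‖ ^ 2 = ∑ p, ‖W c.1 p (colIdx c.2 r)‖ ^ 2 := by
    simp [frobenius_norm_sq, isolate_child_apply W c.2, apply_ite]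
  refine (sq_eq_sq₀ (norm_nonneg _) (by positivity)).1 ?_
  rw [EuclideanSpace.norm_sq_eq, mul_pow, ← Finset.prod_pow,
    ← Finset.prod_coe_sort (T.children v), hself]
  simp only [hchild]
  rw [Fintype.prod_sum, Finset.sum_mul_sum, Fintype.sum_prod_type]
  simp only [localComponent, norm_mul, norm_prod, mul_pow, Finset.prod_pow]

theorem norm_endTensor_isolate_le (r : Fin (R v)) :
    ‖endTensor (isolate W v r)‖ ≤
      localComponentNorm W v r * ∏ w ∈ (insert v (T.children v))ᶜ, ‖W w‖ := by
  have hv : v ∉ T.children v := fun h => (T.lt_of_mem_children h).false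
  refine (norm_endTensor_le _).trans_eq ?_
  rw [← Finset.prod_mul_prod_compl (insert v (T.children v)), Finset.prod_insert hv,
    localComponentNorm_eq_prod_isolate]
  congr 1
  exact Finset.prod_congr rfl fun w hw => by
    rw [isolate_of_notMem W r (Finset.mem_compl.1 hw)]

end Isolate

section Prune

/-- The matrix `A` with the rows in `s` replaced by zero. -/
def eraseRows {m n : Type*} [DecidableEq m] (A : Matrix m n ℝ) (s : Finset m) : Matrix m n ℝ :=
  Matrix.of fun i j => if i ∈ s then 0 else A i j

/-- The weights with the local components in `S` removed: for `r ∈ S v`, row `r` of `W^{(v)}` is set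
to zero. -/
def prune (W : T.Weights R) (S : ∀ v : T.Node, Finset (Fin (R v))) : T.Weights R :=
  fun v => eraseRows (W v) (S v)

theorem localComponentNorm_mono {W W' : T.Weights R}
    (h : ∀ w p q, ‖W w p q‖ ≤ ‖W' w p q‖) (v : T.Node) (r : Fin (R v)) :
    localComponentNorm W v r ≤ localComponentNorm W' v r := by
  simp only [localComponentNorm, EuclideanSpace.norm_eq, localComponent, norm_mul, norm_prod]
  gcongr
  · exact h _ _ _
  · exact h _ _ _

theorem isolate_update_eraseRows_of_notMem (W : T.Weights R) {s : Finset (Fin (R v))}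
    {r : Fin (R v)} (hr : r ∉ s) :
    isolate (Function.update W v (eraseRows (W v) s)) v r = isolate W v r := by
  ext w p q
  rcases eq_or_ne w v with rfl | hw
  · rw [isolate_self_apply, isolate_self_apply, Function.update_self]
    split_ifs with hp
    · simp [eraseRows, hp, hr]
    · rfl
  · simp only [isolate, Matrix.of_apply, Function.update_of_ne hw]

theorem isolate_update_eraseRows_self_of_mem (W : T.Weights R) {s : Finset (Fin (R v))}
    {r : Fin (R v)} (hr : r ∈ s) :
    isolate (Function.update W v (eraseRows (W v) s)) v r v = 0 := by
  ext p q
  rw [isolate_self_apply, Function.update_self, Matrix.zero_apply, ite_eq_right_iff]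
  rintro rfl
  simp [eraseRows, hr]

theorem norm_endTensor_sub_update_eraseRows_le (W : T.Weights R) (v : T.Node)
    (s : Finset (Fin (R v))) :
    ‖endTensor W - endTensor (Function.update W v (eraseRows (W v) s))‖ ≤
      (∑ r ∈ s, localComponentNorm W v r) * ∏ w ∈ (insert v (T.children v))ᶜ, ‖W w‖ := by
  have hdiff : endTensor W - endTensor (Function.update W v (eraseRows (W v) s)) =
      ∑ r ∈ s, endTensor (isolate W v r) := by
    rw [endTensor_eq_sum_isolate W v, endTensor_eq_sum_isolate (Function.update W v _) v,
      ← Finset.sum_add_sum_compl s, ← Finset.sum_add_sum_compl s fun r => endTensor (isolate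
        (Function.update W v _) v r),
      Finset.sum_eq_zero fun r hr =>
        endTensor_eq_zero_of_eq_zero (isolate_update_eraseRows_self_of_mem W hr),
      Finset.sum_congr rfl fun r hr => congrArg endTensor <|
        isolate_update_eraseRows_of_notMem W (Finset.mem_compl.1 hr),
      zero_add, add_sub_cancel_right]
  rw [hdiff, Finset.sum_mul]
  exact norm_sum_le_of_le _ fun r _ => norm_endTensor_isolate_le W r

theorem norm_endTensor_sub_prune_le (W : T.Weights R) (S : ∀ v : T.Node, Finset (Fin (R v))) :
    ‖endTensor W - endTensor (prune W S)‖ ≤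
      ∑ v, (∑ r ∈ S v, localComponentNorm W v r) *
        ∏ w ∈ (insert v (T.children v))ᶜ, ‖W w‖ := by
  rw [← dist_eq_norm]
  refine dist_le_sum_of_dist_update_le endTensor W (prune W S) _ fun v X hv hX => ?_
  have hle (w p q) : ‖X w p q‖ ≤ ‖W w p q‖ := by
    rcases hX w with h | h <;> rw [h]
    by_cases hp : p ∈ S w <;> simp [prune, eraseRows, hp]
  rw [dist_eq_norm, prune, ← hv]
  refine (norm_endTensor_sub_update_eraseRows_le X v (S v)).trans ?_
  gcongr with r _ w _
  · exact Finset.sum_nonneg fun r _ => norm_nonneg _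
  · exact localComponentNorm_mono hle v r
  · exact frobenius_norm_le_of_norm_apply_le (hle w)

end Prune

section Rank

/-- The multi-index over `J` with the entries of `a` at the modes in `I` and those of `b` at the
other modes, as in the definition of `matricize`. -/
def glue {I : Finset (Fin N)} (a : T.Index R I) (b : ∀ j : {n // n ∉ I}, Fin (T.modeDim R j.1))
    (J : Finset (Fin N)) : T.Index R J :=
  fun i => if h : i.1 ∈ I then a ⟨i.1, h⟩ else b ⟨i.1, h⟩

theorem glue_self {I : Finset (Fin N)} (a : T.Index R I)
    (b : ∀ j : {n // n ∉ I}, Fin (T.modeDim R j.1)) : glue a b I = a :=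
  funext fun i => dif_pos i.2

theorem glue_of_disjoint {I J : Finset (Fin N)} (hJ : Disjoint J I) (a : T.Index R I)
    (b : ∀ j : {n // n ∉ I}, Fin (T.modeDim R j.1)) :
    glue a b J = fun i : {n // n ∈ J} => b ⟨i.1, Finset.disjoint_left.1 hJ i.2⟩ :=
  funext fun i => dif_neg (Finset.disjoint_left.1 hJ i.2)

theorem exists_intermediate_glue_eq_sum (W : T.Weights R) (hc : c ∈ T.children u) (hcv : c ≤ v)
    (s : Fin (T.parentDim R u)) (b : ∀ j : {n // n ∉ T.label v}, Fin (T.modeDim R j.1)) :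
    ∃ k : Fin (R u) → ℝ, (∀ r, W u r s = 0 → k r = 0) ∧
      ∀ a, intermediate W u s (glue a b (T.label u)) =
        ∑ r, k r * intermediate W c (colIdx hc r) (glue a b (T.label c)) := by
  have hsibling (c' : {c' // c' ∈ T.children u}) (hne : c' ≠ ⟨c, hc⟩) (r : Fin (R u)) :
      ∃ x, ∀ a, intermediate W c'.1 (colIdx c'.2 r) (glue a b (T.label c'.1)) = x := by
    obtain ⟨h, h'⟩ := T.not_le_of_mem_children_of_ne c'.2 hc (fun he => hne (Subtype.ext he)) hcv
    exact ⟨_, fun a => by rw [glue_of_disjoint (T.disjoint_label h h')]⟩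
  choose! x hx using hsibling
  refine ⟨fun r => W u r s * ∏ c' ∈ Finset.univ.erase ⟨c, hc⟩, x c' r,
    fun r hr => by simp only [hr, zero_mul], fun a => ?_⟩
  rw [intermediate_eq_sum_mul_child W hc]
  refine Finset.sum_congr rfl fun r _ => ?_
  congr 2
  exact Finset.prod_congr rfl fun c' hc' => hx c' (Finset.ne_of_mem_erase hc') r a

theorem intermediate_glue_mem_span (W : T.Weights R) (hc : c ∈ T.children v) (huc : u < c)
    (s : Fin (T.parentDim R u)) (b : ∀ j : {n // n ∉ T.label c}, Fin (T.modeDim R j.1)) :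
    (fun a => intermediate W u s (glue a b (T.label u))) ∈
      Submodule.span ℝ
        (Set.range fun r : {r // W v r ≠ 0} => intermediate W c (colIdx hc r.1)) := by
  induction u using WellFoundedGT.induction with
  | ind u ih =>
    obtain ⟨e, he, hec⟩ := T.exists_mem_children_le huc
    obtain ⟨k, hk, hsum⟩ := exists_intermediate_glue_eq_sum W he hec s b
    have hcomb : (fun a => intermediate W u s (glue a b (T.label u))) =
        ∑ r, k r • fun a => intermediate W e (colIdx he r) (glue a b (T.label e)) := by
      ext a
      simp only [hsum, Finset.sum_apply, Pi.smul_apply, smul_eq_mul]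
    rw [hcomb]
    refine Submodule.sum_mem _ fun r _ => ?_
    rcases hec.eq_or_lt with rfl | hlt
    · obtain rfl : u = v := (T.mem_children.1 he).2.symm.trans (T.mem_children.1 hc).2
      simp only [glue_self]
      by_cases hr : W u r = 0
      · rw [hk r (congrFun hr s), zero_smul]
        exact Submodule.zero_mem _
      · exact Submodule.smul_mem _ _ (Submodule.subset_span ⟨⟨r, hr⟩, rfl⟩)
    · exact Submodule.smul_mem _ _ (ih e (T.lt_of_mem_children he) hlt _)

theorem rank_matricize_endTensor_le (W : T.Weights R) (hc : c ∈ T.children v) :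
    (matricize (endTensor W) (T.label c)).rank ≤ Nat.card {r // W v r ≠ 0} := by
  classical
  rw [Matrix.rank_eq_finrank_span_cols, Nat.card_eq_fintype_card]
  refine (Submodule.finrank_mono (Submodule.span_le.2 ?_)).trans <|
    finrank_range_le_card fun r : {r // W v r ≠ 0} => intermediate W c (colIdx hc r.1)
  rintro _ ⟨b, rfl⟩
  exact intermediate_glue_mem_span W hc (bot_le.trans_lt (T.lt_of_mem_children hc)) _ b

end Rank

section Truncation

variable {R' : T.Node → ℕ}

open Classical in
/-- The indices `r > R'_v` of the local components at the interior node `v`. Since `Fin (R v)`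
starts at `0`, these are the `r` with `R' v ≤ r.val`. -/
noncomputable def excess (R R' : T.Node → ℕ) (v : T.Node) : Finset (Fin (R v)) :=
  {r | T.IsInterior v ∧ R' v ≤ r.val}

theorem endTensor_prune_excess_mem_lowRank (W : T.Weights R) (R' : T.Node → ℕ) :
    endTensor (prune W (excess R R')) ∈ T.lowRank R R' := by
  intro v hv
  have hlt (r : {r // prune W (excess R R') (T.parent v) r ≠ 0}) : r.1.val < R' (T.parent v) := by
    by_contra! hr
    have hmem : r.1 ∈ excess R R' (T.parent v) := by simp [excess, T.isInterior_parent hv, hr]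
    exact r.2 (by ext q; simp [prune, eraseRows, hmem])
  have hinj : Function.Injective fun r => (⟨r.1.val, hlt r⟩ : Fin (R' (T.parent v))) :=
    fun r r' h => Subtype.ext (Fin.ext (Fin.mk.inj h))
  exact (rank_matricize_endTensor_le _ (T.mem_children.2 ⟨hv, rfl⟩)).trans <|
    (Nat.card_le_card_of_injective _ hinj).trans_eq (Nat.card_fin _)

theorem norm_le_maxWeightNorm (W : T.Weights R) (v : T.Node) : ‖W v‖ ≤ maxWeightNorm W :=
  Finset.le_sup' (fun v => ‖W v‖) (Finset.mem_univ v)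

theorem maxWeightNorm_zpow_mul_prod_le_one (W : T.Weights R) (v : T.Node) :
    maxWeightNorm W ^ (((T.children v).card : ℤ) + 1 - (Fintype.card T.Node : ℤ)) *
      ∏ w ∈ (insert v (T.children v))ᶜ, ‖W w‖ ≤ 1 := by
  have hB : 0 ≤ maxWeightNorm W := (norm_nonneg _).trans (norm_le_maxWeightNorm W v)
  have hv : v ∉ T.children v := fun h => (T.lt_of_mem_children h).false
  have hexp : ((T.children v).card : ℤ) + 1 - (Fintype.card T.Node : ℤ) =
      -(((insert v (T.children v))ᶜ : Finset T.Node).card : ℤ) := by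
    rw [← Finset.card_add_card_compl (insert v (T.children v)), Finset.card_insert_of_notMem hv]
    push_cast
    ring
  calc _ ≤ (maxWeightNorm W ^ ((insert v (T.children v))ᶜ).card)⁻¹ *
        maxWeightNorm W ^ ((insert v (T.children v))ᶜ).card := by
        rw [hexp, zpow_neg, zpow_natCast]
        gcongr
        rw [← Finset.prod_const]
        gcongr
        exact norm_le_maxWeightNorm W _
    _ ≤ 1 := inv_mul_le_one

theorem norm_endTensor_sub_prune_excess_le {W : T.Weights R} {ε : ℝ} (hε : 0 ≤ ε)
    (h : ∀ v, T.IsInterior v →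
      ∑ r : Fin (R v) with R' v ≤ r.val, localComponentNorm W v r ≤
        ε * ((Fintype.card T.Node : ℝ) - (N : ℝ))⁻¹ *
          maxWeightNorm W ^ (((T.children v).card : ℤ) + 1 - (Fintype.card T.Node : ℤ))) :
    ‖endTensor W - endTensor (prune W (excess R R'))‖ ≤ ε := by
  classical
  let interior := Finset.univ.filter T.IsInterior
  have hcard : (Fintype.card T.Node : ℝ) - N = interior.card := by
    rw [← T.card_interior_add, Nat.cast_add, add_sub_cancel_right]
  rw [hcard] at h
  have hnode (v : T.Node) : (∑ r ∈ excess R R' v, localComponentNorm W v r) *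
      ∏ w ∈ (insert v (T.children v))ᶜ, ‖W w‖ ≤
        if T.IsInterior v then ε * (interior.card : ℝ)⁻¹ else 0 := by
    split_ifs with hv
    · have hexcess : excess R R' v = ({r | R' v ≤ r.val} : Finset (Fin (R v))) := by
        simp [excess, hv]
      rw [hexcess]
      refine (mul_le_mul_of_nonneg_right (h v hv) (by positivity)).trans ?_
      rw [mul_assoc]
      exact mul_le_of_le_one_right (by positivity) (maxWeightNorm_zpow_mul_prod_le_one W v)
    · simp [excess, hv]
  calc _ ≤ ∑ v, if T.IsInterior v then ε * (interior.card : ℝ)⁻¹ else 0 :=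
        (norm_endTensor_sub_prune_le W _).trans (Finset.sum_le_sum fun v _ => hnode v)
    _ = ε * ((interior.card : ℝ)⁻¹ * interior.card) := by
        rw [← Finset.sum_filter, Finset.sum_const, nsmul_eq_mul]
        ring
    _ ≤ ε := mul_le_of_le_one_right hε inv_mul_le_one

end Truncation

end ModeTree

theorem proposition2 {N : ℕ} (T : ModeTree.{u} N) (R : T.Node → ℕ) (W : T.Weights R)
    (ε : ℝ) (hε : 0 ≤ ε) (R' : T.Node → ℕ)
    (h : ∀ v : T.Node, T.IsInterior v →
      ∑ r : Fin (R v) with R' v ≤ r.val, ModeTree.localComponentNorm W v r ≤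
        ε * ((Fintype.card T.Node : ℝ) - (N : ℝ))⁻¹ *
          ModeTree.maxWeightNorm W ^
            (((T.children v).card : ℤ) + 1 - (Fintype.card T.Node : ℤ))) :
    (∃ A ∈ ModeTree.lowRank T R R', ‖ModeTree.endTensor W - A‖ ≤ ε) ∧
      (⨅ A : ModeTree.lowRank T R R', ‖ModeTree.endTensor W - A.1‖) ≤ ε := by
  obtain ⟨A, hA, hle⟩ : ∃ A ∈ T.lowRank R R', ‖ModeTree.endTensor W - A‖ ≤ ε :=
    ⟨_, ModeTree.endTensor_prune_excess_mem_lowRank W R',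
      ModeTree.norm_endTensor_sub_prune_excess_le hε h⟩
  have hbdd : BddBelow (Set.range fun A : T.lowRank R R' => ‖ModeTree.endTensor W - A.1‖) :=
    ⟨0, Set.forall_mem_range.2 fun _ => norm_nonneg _⟩
  exact ⟨⟨A, hA, hle⟩, (ciInf_le hbdd ⟨A, hA⟩).trans hle⟩
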